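/- **Theorem (Variational Principle for Emergence).** Let $X$ be a non-empty compact metric space with distance $d$, and let $f\colon X\to X$ be continuous. Let $\mathcal M(X)$ be the set of Borel probability measures on $X$, and fix a distance $\mathsf D$ on $\mathcal M(X)$ which is either a Wasserstein distance $$\mathsf W_p(\mu,\nu)=\inf_{\pi}\Big(\int_{X\times X} d(x,y)^p\,d\pi(x,y)\Big)^{1/p},\qquad 1\le p<\infty,$$ the infimum being over all probability measures $\pi$ on $X\times X$ with marginals $\mu$ and $\nu$, or the Lévy–Prokhorov distance. For $\epsilon>0$ define: * the *topological emergence* $\mathcal E_{\mathrm{top}}(f)(\epsilon)$: the minimal number of closed $\mathsf D$-balls of radius $\epsilon$ with centers in $\mathcal M(X)$ whose union contains every ergodic $f$-invariant probability measure; * for $\mu\in\mathcal M(X)$, the *metric emergence* $\mathcal E_\mu(f)(\epsilon)$: the minimal $N$ for which there are $\mu_1,\dots,\mu_N\in\mathcal M(X)$ with $$\limsup_{n\to\infty}\int_X \min_{1\le i\le N}\mathsf D\Big(\frac1n\sum_{k=0}^{n-1}\delta_{f^k(x)},\,\mu_i\Big)\,d\mu(x)\le\epsilon .$$ Then there exists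 an $f$-invariant probability measure $\mu$ on $X$ such that $$\limsup_{\epsilon\to0^+}\frac{\log\log\mathcal E_\mu(f)(\epsilon)}{-\log\epsilon}=\limsup_{\epsilon\to0^+}\frac{\log\log\mathcal E_{\mathrm{top}}(f)(\epsilon)}{-\log\epsilon},$$ $$\liminf_{\epsilon\to0^+}\frac{\log\log\mathcal E_\mu(f)(\epsilon)}{-\log\epsilon}=\liminf_{\epsilon\to0^+}\frac{\log\log\mathcal E_{\mathrm{top}}(f)(\epsilon)}{-\log\epsilon},$$ where both sides take values in $[-\infty,+\infty]$ and $\log 0=-\infty$. -/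

import Mathlib

open MeasureTheory Filter Topology
open scoped ENNReal

namespace Emergence

variable {X : Type*} [MetricSpace X] [MeasurableSpace X]

/-- The transport plans from `μ` to `ν`: probability measures on `X × X` with marginals `μ`, `ν`. -/
def transportPlans (μ ν : Measure X) : Set (Measure (X × X)) :=
  {π | IsProbabilityMeasure π ∧ π.map Prod.fst = μ ∧ π.map Prod.snd = ν}

/-- The `p`-Wasserstein distance, as an extended nonnegative number
(it is finite for probability measures on a compact space). -/
noncomputable def wasserstein (p : ℝ) (μ ν : Measure X) : ℝ≥0∞ :=
  ⨅ π ∈ transportPlans μ ν, (∫⁻ z, edist z.1 z.2 ^ p ∂π) ^ (1 / p)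

/-- The admissible distances on the space of probability measures: the Wasserstein distances `W_p`
with `1 ≤ p < ∞`, and the Lévy–Prokhorov distance. -/
def admissibleDistances (X : Type*) [MetricSpace X] [MeasurableSpace X] :
    Set (Measure X → Measure X → ℝ≥0∞) :=
  {D | (∃ p : ℝ, 1 ≤ p ∧ D = wasserstein p) ∨ D = levyProkhorovEDist}

/-- The `n`-th empirical measure `(1/n) ∑_{i<n} δ_{f^i(x)}` of the point `x`; it is a probability
measure for `n ≥ 1`, and the value at `n = 0` plays no role. -/
noncomputable def empirical (f : X → X) (n : ℕ) (x : X) : Measure X :=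
  (n : ℝ≥0∞)⁻¹ • ∑ i ∈ Finset.range n, Measure.dirac (f^[i] x)

/-- The topological emergence of `f` at scale `ε`: the minimal number of closed `ε`-balls, centred
at probability measures, whose union contains all ergodic `f`-invariant probability measures. -/
noncomputable def topologicalEmergence (D : Measure X → Measure X → ℝ≥0∞) (f : X → X) (ε : ℝ) :
    ℕ∞ :=
  ⨅ (F : Finset (ProbabilityMeasure X))
    (_ : ∀ η : ProbabilityMeasure X, Ergodic f (η : Measure X) →
      ∃ ν ∈ F, D (η : Measure X) (ν : Measure X) ≤ ENNReal.ofReal ε), (F.card : ℕ∞)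

/-- The metric emergence of `μ` at scale `ε`: the minimal number of probability measures
`μ_1, …, μ_N` such that `limsup_n ∫ min_i D (e_n(x), μ_i) dμ(x) ≤ ε`.
(For the empty family the minimum is `∞`, so the empty family never qualifies.) -/
noncomputable def metricEmergence (D : Measure X → Measure X → ℝ≥0∞) (f : X → X)
    (μ : Measure X) (ε : ℝ) : ℕ∞ :=
  ⨅ (F : Finset (ProbabilityMeasure X))
    (_ : limsup (fun n : ℕ => ∫⁻ x, ⨅ ν ∈ F, D (empirical f n x) (ν : Measure X) ∂μ) atTop
      ≤ ENNReal.ofReal ε), (F.card : ℕ∞)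

/-- The quotient `log log N / (- log ε)` in the extended reals, for `N ≥ 1`, with the conventions
`log 0 = -∞` and `log ∞ = ∞`. Since `log N ≥ 0`, the conversion `toENNReal` loses nothing. -/
noncomputable def logLogRatio (N : ℕ∞) (ε : ℝ) : EReal :=
  ENNReal.log (ENNReal.log (N : ℝ≥0∞)).toENNReal / ((-Real.log ε : ℝ) : EReal)

end Emergence

/-!
The invariant measure with maximal emergence is a countable mixture of ergodic measures. For each
`j` let `S j` be a maximal set of ergodic measures that are pairwise more than `δ j = 2 ^ (-j ^ 2)`
apart; it is finite, and by maximality the `δ j`-balls around it cover the ergodic measures.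
Put `μ = ∑ j, 2 ^ (-(j + 1)) • (average of the measures in S j)`.

The empirical measures of an ergodic component `η` converge to `η` in `η`-measure
(`exists_bad_sets`), so for a mixture `∑ c i • η i` the condition in the definition of metric
emergence says exactly that the centres `F` satisfy `∑ c i * D(η i, F) ≤ ε`
(`limsup_lintegral_le_iff`). This gives two comparisons.

* A cover of the ergodic measures by `ε`-balls has this property, so the metric emergence is at most
  the topological emergence (`metricEmergence_le_topologicalEmergence`).
* Conversely a centre lies within `δ j / 2` of at most one point of `S j`, so a family `F` of at
  most half the size of `S j` is at distance at least `δ j / 2` from half of `S j`, and the average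
  distance is at least `2 ^ (-(j + 1)) * δ j / 4`. Below this scale `F` has to satisfy
  `#(S j) < 2 * #F`, whence `#(S j) ≤ #F ^ 2` (`card_lt_of_sum_infDistTo_le`).

Both the weights and the ratios of consecutive scales are subpolynomial in `δ j`, so for every
`s > 0` and all small `ε` the topological emergence at `ε` is at most the square of the metric
emergence at `ε ^ (1 + s)`. Taking `log log`, the square becomes an additive constant and the
exponent a factor `1 + s`; both disappear in the limit (`limsup_liminf_logLogRatio_eq`).

Besides symmetry and the triangle inequality, only two properties of the distance are used: it is
bounded, and two probability measures are close as soon as they nearly agree on the cells of a fine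
finite partition (`IsPartitionDist`). For the Wasserstein distances the triangle inequality is
obtained by gluing transport plans along a conditional kernel. As the cells of a partition suffice,
convergence of the empirical measures follows from von Neumann's mean ergodic theorem applied to
indicator functions; neither the pointwise ergodic theorem nor the ergodic decomposition is needed.
-/

namespace Emergence

/-! ### Distances controlled by finite partitions -/

/-- Compactness gives finite measurable partitions of small mesh, encoded as the fibres of a simple
function that is uniformly close to the identity. -/
theorem exists_simpleFunc_edist_lt {X : Type*} [MetricSpace X] [CompactSpace X] [Nonempty X]
    [MeasurableSpace X] [BorelSpace X] {δ : ℝ≥0∞} (hδ : 0 < δ) :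
    ∃ q : SimpleFunc X X, ∀ x, edist (q x) x < δ := by
  classical
  let e := TopologicalSpace.denseSeq X
  obtain ⟨t, ht⟩ := (isCompact_univ (X := X)).elim_finite_subcover
    (fun k : ℕ => Metric.eball (e k) δ) (fun k => Metric.isOpen_eball) (by
      intro x _
      obtain ⟨_, ⟨k, rfl⟩, hk⟩ := EMetric.mem_closure_iff.1
        (TopologicalSpace.denseRange_denseSeq X x) δ hδ
      exact Set.mem_iUnion.2 ⟨k, hk⟩)
  refine ⟨SimpleFunc.nearestPt e (t.sup id), fun x => ?_⟩
  obtain ⟨k, hk, hx⟩ := Set.mem_iUnion₂.1 (ht (Set.mem_univ x))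
  refine (SimpleFunc.edist_nearestPt_le e x (Finset.le_sup (f := id) hk)).trans_lt ?_
  rw [edist_comm]; exact hx

/-- The properties of a distance between probability measures on which the argument rests: it is
symmetric, satisfies the triangle inequality, is bounded, and is controlled by the masses of
finitely many measurable sets, in the sense that measures whose masses differ by at most `τ` on
these sets are `ε`-close. Nothing is asked of the values of `D` at measures that are not probability
measures. -/
structure IsPartitionDist {X : Type*} [MeasurableSpace X]
    (D : Measure X → Measure X → ℝ≥0∞) : Prop where
  symm : ∀ (μ ν : Measure X) [IsProbabilityMeasure μ] [IsProbabilityMeasure ν], D μ ν = D ν μ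
  triangle : ∀ (μ ν κ : Measure X) [IsProbabilityMeasure μ] [IsProbabilityMeasure ν]
    [IsProbabilityMeasure κ], D μ κ ≤ D μ ν + D ν κ
  bounded : ∃ C : ℝ≥0∞, C ≠ ∞ ∧
    ∀ (μ ν : Measure X) [IsProbabilityMeasure μ] [IsProbabilityMeasure ν], D μ ν ≤ C
  approx : ∀ ε : ℝ, 0 < ε → ∃ (S : Finset (Set X)) (τ : ℝ), 0 < τ ∧ (∀ A ∈ S, MeasurableSet A) ∧
    ∀ (μ ν : Measure X) [IsProbabilityMeasure μ] [IsProbabilityMeasure ν],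
      (∀ A ∈ S, |μ.real A - ν.real A| ≤ τ) → D μ ν ≤ ENNReal.ofReal ε

theorem measure_preimage_eq_sum_fibers {X Y : Type*} [MeasurableSpace X] (q : SimpleFunc X Y)
    (μ : Measure X) (s : Set Y) [DecidablePred (· ∈ s)] :
    μ (q ⁻¹' s) = ∑ y ∈ q.range with y ∈ s, μ (q ⁻¹' {y}) := by
  rw [← measure_biUnion_finset]
  · congr 1; ext x; simp
  · intro a _ b _ hab
    refine Set.disjoint_left.2 fun x hx hx' => hab ?_
    simp_all
  · intro y _; exact q.measurableSet_fiber y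

theorem isPartitionDist_levyProkhorovEDist {X : Type*} [MetricSpace X] [MeasurableSpace X]
    [CompactSpace X] [Nonempty X] [BorelSpace X] :
    IsPartitionDist (X := X) levyProkhorovEDist where
  symm μ ν _ _ := levyProkhorovEDist_comm μ ν
  triangle μ ν κ _ _ _ := levyProkhorovEDist_triangle μ ν κ
  bounded := ⟨1, by simp, fun μ ν _ _ =>
    (levyProkhorovEDist_le_max_measure_univ μ ν).trans (by simp)⟩
  -- the fibres of a simple function `q` close to the identity serve as partition: a set `B` is
  -- contained in the union of the fibres that meet it, and that union lies in a thickening of `B`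
  approx ε hε := by
    classical
    obtain ⟨q, hq⟩ := exists_simpleFunc_edist_lt (X := X) (δ := ENNReal.ofReal (ε / 2))
      (by simpa using hε)
    have key : ∀ (μ ν : Measure X) [IsProbabilityMeasure μ] [IsProbabilityMeasure ν],
        (∀ y ∈ q.range, |μ.real (q ⁻¹' {y}) - ν.real (q ⁻¹' {y})| ≤ ε / (q.range.card + 1)) →
        ∀ B : Set X, μ B ≤ ν (Metric.thickening ε B) + ENNReal.ofReal ε := by
      intro μ ν _ _ h B
      have hB : B ⊆ q ⁻¹' (q '' B) := Set.subset_preimage_image _ _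
      have hB' : q ⁻¹' (q '' B) ⊆ Metric.thickening ε B := by
        rintro x ⟨b, hb, hbx⟩
        refine Metric.mem_thickening_iff.2 ⟨b, hb, ?_⟩
        have h1 := hq x
        have h2 := hq b
        rw [hbx] at h2
        rw [edist_dist, ENNReal.ofReal_lt_ofReal_iff (by positivity)] at h1 h2
        have := dist_triangle_left x b (q x)
        linarith
      have hreal : μ.real (q ⁻¹' (q '' B)) ≤ ν.real (q ⁻¹' (q '' B)) + ε := by
        simp only [Measure.real, measure_preimage_eq_sum_fibers q _ (q '' B)]
        rw [ENNReal.toReal_sum (by simp), ENNReal.toReal_sum (by simp)]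
        have : ∀ y ∈ q.range.filter (· ∈ q '' B), (μ (q ⁻¹' {y})).toReal ≤
            (ν (q ⁻¹' {y})).toReal + ε / (q.range.card + 1) := by
          intro y hy
          have := (abs_le.1 (h y (Finset.mem_filter.1 hy).1)).2
          simp only [Measure.real] at this
          linarith
        refine (Finset.sum_le_sum this).trans ?_
        rw [Finset.sum_add_distrib, Finset.sum_const, nsmul_eq_mul]
        gcongr
        have hc : ((q.range.filter (· ∈ q '' B)).card : ℝ) ≤ q.range.card + 1 := by
          have := Finset.card_filter_le q.range (· ∈ q '' B)
          have : ((q.range.filter (· ∈ q '' B)).card : ℝ) ≤ q.range.card := by exact_mod_cast this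
          linarith
        rw [mul_div_assoc', div_le_iff₀ (by positivity), mul_comm]
        gcongr
      calc μ B ≤ μ (q ⁻¹' (q '' B)) := measure_mono hB
        _ = ENNReal.ofReal (μ.real (q ⁻¹' (q '' B))) := by simp
        _ ≤ ENNReal.ofReal (ν.real (q ⁻¹' (q '' B)) + ε) := ENNReal.ofReal_le_ofReal hreal
        _ = ν (q ⁻¹' (q '' B)) + ENNReal.ofReal ε := by
          rw [ENNReal.ofReal_add (by positivity) hε.le]; simp
        _ ≤ _ := by gcongr
    refine ⟨q.range.image (fun y => q ⁻¹' {y}), ε / (q.range.card + 1), by positivity, ?_, ?_⟩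
    · simp only [Finset.mem_image]
      rintro _ ⟨y, _, rfl⟩
      exact q.measurableSet_fiber y
    · intro μ ν _ _ h
      have h' : ∀ y ∈ q.range,
          |μ.real (q ⁻¹' {y}) - ν.real (q ⁻¹' {y})| ≤ ε / (q.range.card + 1) :=
        fun y hy => h _ (Finset.mem_image_of_mem _ hy)
      refine sInf_le fun B _ => ?_
      rw [ENNReal.toReal_ofReal hε.le]
      exact ⟨key μ ν h' B, key ν μ (fun y hy => by rw [abs_sub_comm]; exact h' y hy) B⟩

/-! ### The Wasserstein distances -/

theorem isProbabilityMeasure_of_map_fst {X : Type*} [MeasurableSpace X]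
    {π : Measure (X × X)} {μ : Measure X} [IsProbabilityMeasure μ] (h : π.map Prod.fst = μ) :
    IsProbabilityMeasure π := by
  constructor
  have := measure_univ (μ := μ)
  rwa [← h, Measure.map_apply measurable_fst .univ] at this

theorem map_simpleFunc_eq_sum_dirac {X Y : Type*} [MeasurableSpace X] [MeasurableSpace Y]
    (q : SimpleFunc X Y) (μ : Measure X) (hq : Measurable q) :
    μ.map q = ∑ y ∈ q.range, μ (q ⁻¹' {y}) • Measure.dirac y := by
  classical
  ext s hs
  rw [Measure.map_apply hq hs, measure_preimage_eq_sum_fibers, Finset.sum_filter]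
  simp [Measure.dirac_apply' _ hs, Set.indicator_apply]

theorem edist_le_ofReal_diam_univ {X : Type*} [MetricSpace X] [CompactSpace X]
    (x y : X) : edist x y ≤ ENNReal.ofReal (Metric.diam (Set.univ : Set X)) := by
  rw [edist_dist]
  exact ENNReal.ofReal_le_ofReal
    (Metric.dist_le_diam_of_mem isCompact_univ.isBounded trivial trivial)

section
variable {X : Type*} [MetricSpace X] [MeasurableSpace X]

theorem wasserstein_le {p : ℝ} {μ ν : Measure X} [IsProbabilityMeasure μ] {π : Measure (X × X)}
    (h₁ : π.map Prod.fst = μ) (h₂ : π.map Prod.snd = ν) :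
    wasserstein p μ ν ≤ (∫⁻ z, edist z.1 z.2 ^ p ∂π) ^ (1 / p) :=
  iInf₂_le π ⟨isProbabilityMeasure_of_map_fst h₁, h₁, h₂⟩

variable [CompactSpace X] [BorelSpace X]

theorem measurable_edist_rpow (p : ℝ) : Measurable fun z : X × X => edist z.1 z.2 ^ p :=
  measurable_edist.pow_const p

theorem wasserstein_le_swap (p : ℝ) (μ ν : Measure X) [IsProbabilityMeasure μ] :
    wasserstein p μ ν ≤ wasserstein p ν μ := by
  refine le_iInf₂ fun π hπ => ?_
  have hπ' := hπ.2
  refine (wasserstein_le (π := π.map Prod.swap) ?_ ?_).trans_eq ?_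
  · rw [Measure.map_map measurable_fst measurable_swap]; exact hπ'.2
  · rw [Measure.map_map measurable_snd measurable_swap]; exact hπ'.1
  · rw [lintegral_map (measurable_edist_rpow p) measurable_swap]
    simp [edist_comm]

theorem wasserstein_triangle {p : ℝ} (hp : 1 ≤ p) (μ ν κ : Measure X) [IsProbabilityMeasure μ]
    [IsProbabilityMeasure ν] [IsProbabilityMeasure κ] :
    wasserstein p μ κ ≤ wasserstein p μ ν + wasserstein p ν κ := by
  have : Nonempty X := μ.nonempty_of_neZero
  simp only [wasserstein, ENNReal.iInf_add, ENNReal.add_iInf]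
  refine le_iInf₂ fun π₂ h₂ => le_iInf₂ fun π₁ h₁ => ?_
  obtain ⟨_, h₁f, h₁s⟩ := h₁
  obtain ⟨_, h₂f, h₂s⟩ := h₂
  -- glue the two plans along their common marginal
  let γ : Measure ((X × X) × X) := π₁.compProd (π₂.condKernel.comap Prod.snd measurable_snd)
  have hγ₁ : γ.map Prod.fst = π₁ := Measure.fst_compProd _ _
  have hγ₂ : γ.map (fun a => (a.1.2, a.2)) = π₂ := by
    have hm : Measurable fun a : (X × X) × X => (a.1.2, a.2) := by fun_prop
    conv_rhs => rw [← π₂.disintegrate π₂.condKernel]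
    ext s hs
    rw [Measure.map_apply hm hs, Measure.compProd_apply (hm hs), Measure.compProd_apply hs,
      Measure.fst, h₂f, ← h₁s, lintegral_map _ measurable_snd]
    · rfl
    · exact ProbabilityTheory.Kernel.measurable_kernel_prodMk_left hs
  have hm : Measurable fun a : (X × X) × X => (a.1.1, a.2) := by fun_prop
  refine (iInf₂_le (γ.map fun a => (a.1.1, a.2)) ?_).trans ?_
  · have e₁ : (γ.map fun a => (a.1.1, a.2)).map Prod.fst = μ := by
      rw [Measure.map_map measurable_fst hm, ← h₁f, ← hγ₁,
        Measure.map_map measurable_fst measurable_fst]; rfl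
    refine ⟨isProbabilityMeasure_of_map_fst e₁, e₁, ?_⟩
    rw [Measure.map_map measurable_snd hm, ← h₂s, ← hγ₂,
      Measure.map_map measurable_snd (by fun_prop)]; rfl
  · rw [lintegral_map (measurable_edist_rpow p) hm]
    have i₁ : ∫⁻ z, edist z.1 z.2 ^ p ∂π₁ = ∫⁻ a, edist a.1.1 a.1.2 ^ p ∂γ := by
      conv_lhs => rw [← hγ₁]
      rw [lintegral_map (measurable_edist_rpow p) measurable_fst]
    have i₂ : ∫⁻ z, edist z.1 z.2 ^ p ∂π₂ = ∫⁻ a, edist a.1.2 a.2 ^ p ∂γ := by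
      conv_lhs => rw [← hγ₂]
      rw [lintegral_map (measurable_edist_rpow p) (by fun_prop)]
    rw [i₁, i₂]
    have hf : Measurable fun a : (X × X) × X => edist a.1.1 a.1.2 := by fun_prop
    have hg : Measurable fun a : (X × X) × X => edist a.1.2 a.2 := by fun_prop
    refine le_trans ?_ (ENNReal.lintegral_Lp_add_le hf.aemeasurable hg.aemeasurable hp)
    gcongr with a
    exact edist_triangle _ _ _

theorem wasserstein_map_le {p : ℝ} (hp : 1 ≤ p) (μ : Measure X) [IsProbabilityMeasure μ]
    {q : X → X} (hq : Measurable q) {δ : ℝ≥0∞} (h : ∀ x, edist (q x) x ≤ δ) :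
    wasserstein p μ (μ.map q) ≤ δ := by
  have hm : Measurable fun x => (x, q x) := by fun_prop
  refine (wasserstein_le (π := μ.map fun x => (x, q x)) ?_ ?_).trans ?_
  · rw [Measure.map_map measurable_fst hm]; exact Measure.map_id
  · rw [Measure.map_map measurable_snd hm]; rfl
  · rw [lintegral_map (measurable_edist_rpow p) hm]
    calc (∫⁻ x, edist x (q x) ^ p ∂μ) ^ (1 / p) ≤ (∫⁻ _, δ ^ p ∂μ) ^ (1 / p) := by
          gcongr with x; rw [edist_comm]; exact h x
      _ = δ := by
          rw [lintegral_const, measure_univ, mul_one, one_div,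
            ENNReal.rpow_rpow_inv (by positivity)]

/-- Two measures with a large common part `m` are close: the plan keeps `m` in place and sends
the remainder `μ'` to the remainder `ν'` by a multiple of the product measure. -/
theorem wasserstein_add_le {p : ℝ} (hp : 1 ≤ p) {C : ℝ≥0∞} (hC : ∀ x y : X, edist x y ≤ C)
    (m μ' ν' : Measure X) [IsProbabilityMeasure (m + μ')] {r : ℝ≥0∞} (hr : r ≠ ∞)
    (hμ' : μ' Set.univ = r) (hν' : ν' Set.univ = r) :
    wasserstein p (m + μ') (m + ν') ≤ (C ^ p * r) ^ (1 / p) := by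
  have : IsFiniteMeasure μ' := ⟨by rw [hμ']; exact hr.lt_top⟩
  have : IsFiniteMeasure ν' := ⟨by rw [hν']; exact hr.lt_top⟩
  have hd : Measurable fun x : X => (x, x) := by fun_prop
  -- also for `r = 0`, where `ρ = 0` absorbs the infinite factor `r⁻¹`
  have key : ∀ ρ : Measure X, ρ Set.univ = r → r⁻¹ • r • ρ = ρ := by
    intro ρ hρ
    rcases eq_or_ne r 0 with rfl | h0
    · simp [Measure.measure_univ_eq_zero.1 hρ]
    · rw [smul_smul, ENNReal.inv_mul_cancel h0 hr, one_smul]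
  refine (wasserstein_le (π := m.map (fun x => (x, x)) + r⁻¹ • μ'.prod ν') ?_ ?_).trans ?_
  · rw [Measure.map_add _ _ measurable_fst, Measure.map_map measurable_fst hd, Measure.map_smul,
      Measure.map_fst_prod, hν', key μ' hμ']
    congr 1; exact Measure.map_id
  · rw [Measure.map_add _ _ measurable_snd, Measure.map_map measurable_snd hd, Measure.map_smul,
      Measure.map_snd_prod, hμ', key ν' hν']
    congr 1; exact Measure.map_id
  · gcongr
    rw [lintegral_add_measure, lintegral_map (measurable_edist_rpow p) hd]
    simp only [edist_self, ENNReal.zero_rpow_of_pos (zero_lt_one.trans_le hp), lintegral_zero,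
      zero_add]
    rw [lintegral_smul_measure]
    calc r⁻¹ • ∫⁻ z, edist z.1 z.2 ^ p ∂(μ'.prod ν')
        ≤ r⁻¹ • ∫⁻ _, C ^ p ∂(μ'.prod ν') := by gcongr; exact hC _ _
      _ = (r⁻¹ * r) * (C ^ p * r) := by
          rw [lintegral_const, ← Set.univ_prod_univ, Measure.prod_prod, hμ', hν', smul_eq_mul]; ring
      _ ≤ 1 * (C ^ p * r) := by gcongr; exact ENNReal.inv_mul_le_one r
      _ = _ := one_mul _

/-- Discretizing both measures along `q` and matching the atoms as far as possible bounds their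
Wasserstein distance by the mesh of `q` and the differences of the masses of the fibres. -/
theorem wasserstein_le_of_simpleFunc {p : ℝ} (hp : 1 ≤ p) {δ C t : ℝ≥0∞}
    (hC : ∀ x y : X, edist x y ≤ C) (q : SimpleFunc X X) (hq : ∀ x, edist (q x) x ≤ δ)
    (μ ν : Measure X) [IsProbabilityMeasure μ] [IsProbabilityMeasure ν]
    (h : ∀ y ∈ q.range, μ (q ⁻¹' {y}) ≤ ν (q ⁻¹' {y}) + t) :
    wasserstein p μ ν ≤ δ + (C ^ p * (q.range.card * t)) ^ (1 / p) + δ := by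
  -- `m` is the common part of the two discretized measures, `μ'` and `ν'` are the remainders
  let a : X → ℝ≥0∞ := fun y => μ (q ⁻¹' {y})
  let b : X → ℝ≥0∞ := fun y => ν (q ⁻¹' {y})
  let m : Measure X := ∑ y ∈ q.range, min (a y) (b y) • Measure.dirac y
  let μ' : Measure X := ∑ y ∈ q.range, (a y - b y) • Measure.dirac y
  let ν' : Measure X := ∑ y ∈ q.range, (b y - a y) • Measure.dirac y
  have eμ : μ.map q = m + μ' := by
    rw [map_simpleFunc_eq_sum_dirac q μ q.measurable, ← Finset.sum_add_distrib]
    refine Finset.sum_congr rfl fun y _ => ?_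
    rw [← add_smul]; congr 1
    rcases le_total (a y) (b y) with h | h
    · rw [min_eq_left h, tsub_eq_zero_of_le h, add_zero]
    · rw [min_eq_right h, add_tsub_cancel_of_le h]
  have eν : ν.map q = m + ν' := by
    rw [map_simpleFunc_eq_sum_dirac q ν q.measurable, ← Finset.sum_add_distrib]
    refine Finset.sum_congr rfl fun y _ => ?_
    rw [← add_smul]; congr 1
    rcases le_total (b y) (a y) with h | h
    · rw [min_eq_right h, tsub_eq_zero_of_le h, add_zero]
    · rw [min_eq_left h, add_tsub_cancel_of_le h]
  have pμ : IsProbabilityMeasure (μ.map q) :=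
    Measure.isProbabilityMeasure_map q.measurable.aemeasurable
  have pν : IsProbabilityMeasure (ν.map q) :=
    Measure.isProbabilityMeasure_map q.measurable.aemeasurable
  have uμ : m Set.univ + μ' Set.univ = 1 := by
    rw [← Measure.add_apply, ← eμ]; exact measure_univ
  have uν : m Set.univ + ν' Set.univ = 1 := by
    rw [← Measure.add_apply, ← eν]; exact measure_univ
  have hm : m Set.univ ≠ ∞ := by
    intro h; simp [h] at uμ
  have hr : μ' Set.univ ≤ q.range.card * t := by
    simp only [μ', Measure.finsetSum_apply, Measure.smul_apply, measure_univ, smul_eq_mul, mul_one]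
    rw [← nsmul_eq_mul]
    exact Finset.sum_le_card_nsmul _ _ _ fun y hy => tsub_le_iff_left.2 (h y hy)
  have hν' : ν' Set.univ = μ' Set.univ := by
    rw [← ENNReal.add_right_inj hm, uμ, uν]
  have hr' : μ' Set.univ ≠ ∞ := by
    intro h; simp [h] at uμ
  have : IsProbabilityMeasure (m + μ') := eμ ▸ pμ
  calc wasserstein p μ ν
      ≤ wasserstein p μ (μ.map q) + wasserstein p (μ.map q) (ν.map q)
        + wasserstein p (ν.map q) ν := by
        refine (wasserstein_triangle hp μ (ν.map q) ν).trans ?_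
        gcongr
        exact wasserstein_triangle hp μ (μ.map q) (ν.map q)
    _ ≤ δ + (C ^ p * (q.range.card * t)) ^ (1 / p) + δ := by
        gcongr
        · exact wasserstein_map_le hp μ q.measurable hq
        · rw [eμ, eν]
          refine (wasserstein_add_le hp hC m μ' ν' hr' rfl hν').trans ?_
          gcongr
        · exact (wasserstein_le_swap p _ ν).trans (wasserstein_map_le hp ν q.measurable hq)

theorem isPartitionDist_wasserstein [Nonempty X] {p : ℝ} (hp : 1 ≤ p) :
    IsPartitionDist (X := X) (wasserstein p) where
  symm μ ν _ _ := le_antisymm (wasserstein_le_swap p μ ν) (wasserstein_le_swap p ν μ)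
  triangle μ ν κ _ _ _ := wasserstein_triangle hp μ ν κ
  -- the product measure is a transport plan, of cost at most the diameter
  bounded := by
    refine ⟨ENNReal.ofReal (Metric.diam (Set.univ : Set X)), ENNReal.ofReal_ne_top,
      fun μ ν _ _ => ?_⟩
    have : IsProbabilityMeasure (0 + μ) := by rwa [zero_add]
    have := wasserstein_add_le hp edist_le_ofReal_diam_univ (0 : Measure X) μ ν (r := 1) (by simp)
      measure_univ measure_univ
    rwa [zero_add, zero_add, mul_one, one_div, ENNReal.rpow_rpow_inv (by positivity)] at this
  approx ε hε := by
    classical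
    have hp0 : 0 < p := by linarith
    obtain ⟨q, hq⟩ := exists_simpleFunc_edist_lt (X := X) (δ := ENNReal.ofReal (ε / 4))
      (by simpa using hε)
    set K := Metric.diam (Set.univ : Set X) with hK
    have hK0 : 0 ≤ K := Metric.diam_nonneg
    -- the tolerance that makes the transport cost of the unmatched mass at most `ε / 2`
    let τ : ℝ := (ε / 2) ^ p / ((K ^ p + 1) * (q.range.card + 1))
    have hKp : 0 ≤ K ^ p := by positivity
    have hτ : 0 < τ := by positivity
    refine ⟨q.range.image (fun y => q ⁻¹' {y}), τ, hτ, ?_, ?_⟩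
    · simp only [Finset.mem_image]
      rintro _ ⟨y, _, rfl⟩
      exact q.measurableSet_fiber y
    · intro μ ν _ _ h
      have h' : ∀ y ∈ q.range, μ (q ⁻¹' {y}) ≤ ν (q ⁻¹' {y}) + ENNReal.ofReal τ := by
        intro y hy
        have := (abs_le.1 (h _ (Finset.mem_image_of_mem _ hy))).2
        have : μ.real (q ⁻¹' {y}) ≤ ν.real (q ⁻¹' {y}) + τ := by linarith
        have := ENNReal.ofReal_le_ofReal this
        rwa [ENNReal.ofReal_add (by positivity) hτ.le, ofReal_measureReal, ofReal_measureReal]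
          at this
      refine (wasserstein_le_of_simpleFunc hp edist_le_ofReal_diam_univ q (fun x => (hq x).le)
        μ ν h').trans ?_
      have hc : K ^ p * (q.range.card * τ) ≤ (ε / 2) ^ p := by
        have : (K ^ p * q.range.card) ≤ (K ^ p + 1) * (q.range.card + 1) := by
          gcongr <;> linarith
        calc K ^ p * (q.range.card * τ) = (K ^ p * q.range.card) * τ := by ring
          _ ≤ ((K ^ p + 1) * (q.range.card + 1)) * τ := by gcongr
          _ = (ε / 2) ^ p := by simp only [τ]; field_simp
      have hc' : (ENNReal.ofReal K ^ p * (q.range.card * ENNReal.ofReal τ)) ^ (1 / p)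
          ≤ ENNReal.ofReal (ε / 2) := by
        rw [one_div, ENNReal.rpow_inv_le_iff hp0, ENNReal.ofReal_rpow_of_nonneg hK0 hp0.le,
          ENNReal.ofReal_rpow_of_nonneg (by positivity) hp0.le, ← ENNReal.ofReal_natCast,
          ← ENNReal.ofReal_mul (by positivity), ← ENNReal.ofReal_mul (by positivity)]
        exact ENNReal.ofReal_le_ofReal hc
      calc _ ≤ ENNReal.ofReal (ε / 4) + ENNReal.ofReal (ε / 2) + ENNReal.ofReal (ε / 4) := by
            gcongr
        _ = ENNReal.ofReal ε := by
            rw [← ENNReal.ofReal_add (by positivity) (by positivity),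
              ← ENNReal.ofReal_add (by positivity) (by positivity)]
            congr 1; ring
end

theorem isPartitionDist_of_mem_admissibleDistances {X : Type*} [MetricSpace X] [CompactSpace X]
    [Nonempty X] [MeasurableSpace X] [BorelSpace X] {D : Measure X → Measure X → ℝ≥0∞}
    (hD : D ∈ admissibleDistances X) : IsPartitionDist D := by
  rcases hD with ⟨p, hp, rfl⟩ | rfl
  · exact isPartitionDist_wasserstein hp
  · exact isPartitionDist_levyProkhorovEDist

/-! ### The mean ergodic theorem and empirical measures -/

section
variable {X : Type*} [MeasurableSpace X] {f : X → X} {η : Measure X}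

/-- The Koopman operator `g ↦ g ∘ f` on `L²(η)`. -/
noncomputable def koopman (hf : MeasurePreserving f η η) : Lp ℝ 2 η →L[ℝ] Lp ℝ 2 η :=
  (Lp.compMeasurePreservingₗᵢ ℝ f hf).toContinuousLinearMap

theorem koopman_iterate_toLp (hf : MeasurePreserving f η η) {g : X → ℝ} (hg : MemLp g 2 η) (n : ℕ) :
    (koopman hf)^[n] (hg.toLp g) = (hg.comp_measurePreserving (hf.iterate n)).toLp _ := by
  induction n with
  | zero => rfl
  | succ n ih =>
    rw [Function.iterate_succ_apply', ih]
    rfl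

theorem birkhoffAverage_koopman_toLp (hf : MeasurePreserving f η η) {g : X → ℝ}
    (hg : MemLp g 2 η) (n : ℕ) :
    (birkhoffAverage ℝ (koopman hf) (fun v : Lp ℝ 2 η => v) n (hg.toLp g) : Lp ℝ 2 η) =ᵐ[η]
      birkhoffAverage ℝ f g n := by
  have h1 : ∀ n, (birkhoffSum (koopman hf) (fun v : Lp ℝ 2 η => v) n (hg.toLp g) : Lp ℝ 2 η) =ᵐ[η]
      birkhoffSum f g n := by
    intro n
    induction n with
    | zero => 
      simp only [birkhoffSum_zero]
      exact Lp.coeFn_zero _ _ _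
    | succ n ih =>
      rw [birkhoffSum_succ]
      refine (Lp.coeFn_add _ _).trans ?_
      filter_upwards [ih, (hg.comp_measurePreserving (hf.iterate n)).coeFn_toLp] with x h1 h2
      rw [Pi.add_apply, h1, birkhoffSum_succ, koopman_iterate_toLp, h2]
      rfl
  refine (Lp.coeFn_smul _ _).trans ?_
  filter_upwards [h1 n] with x hx
  simp only [Pi.smul_apply, hx, birkhoffAverage]

/-- **Mean ergodic theorem** for an ergodic probability measure: the Birkhoff averages of a
square-integrable function converge to its integral in measure. -/
theorem tendstoInMeasure_birkhoffAverage [IsProbabilityMeasure η] (hη : Ergodic f η) {g : X → ℝ}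
    (hg : MemLp g 2 η) :
    TendstoInMeasure η (fun n => birkhoffAverage ℝ f g n) atTop (fun _ => ∫ x, g x ∂η) := by
  have hf := hη.toMeasurePreserving
  set U := koopman hf
  set u : Lp ℝ 2 η := hg.toLp g
  set E := U.eqLocus (1 : Lp ℝ 2 η →L[ℝ] Lp ℝ 2 η)
  set P := E.orthogonalProjectionOnto u with hP
  have hlim : Tendsto (fun n => birkhoffAverage ℝ U id n u) atTop (𝓝 (P : Lp ℝ 2 η)) :=
    U.tendsto_birkhoffAverage_orthogonalProjection
      (LinearIsometry.norm_toContinuousLinearMap_le _) u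
  have hPfix : U P = P := P.2
  -- the limit is invariant, hence constant
  obtain ⟨c, hc⟩ : ∃ c : ℝ, (P : Lp ℝ 2 η) =ᵐ[η] Function.const X c := by
    refine hη.ae_eq_const_of_ae_eq_comp_ae (Lp.aestronglyMeasurable _) ?_
    refine (Lp.coeFn_compMeasurePreserving (P : Lp ℝ 2 η) hf).symm.trans ?_
    have : Lp.compMeasurePreserving f hf (P : Lp ℝ 2 η) = P := hPfix
    rw [this]
  -- the constant is the integral, since the projection preserves the pairing with constants
  have hc' : c = ∫ x, g x ∂η := by
    have h1 : MemLp (fun _ : X => (1 : ℝ)) 2 η := memLp_const 1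
    have hone : h1.toLp _ ∈ E := by
      change U _ = _
      rfl
    have h0 : inner ℝ (u - P : Lp ℝ 2 η) (h1.toLp _) = 0 :=
      E.starProjection_inner_eq_zero u _ hone
    have hint : ∀ v : Lp ℝ 2 η, inner ℝ v (h1.toLp _) = ∫ x, v x ∂η := by
      intro v
      rw [L2.inner_def]
      refine integral_congr_ae ?_
      filter_upwards [h1.coeFn_toLp] with x hx
      rw [hx]
      simp
    rw [inner_sub_left, hint, hint, sub_eq_zero, integral_congr_ae hc,
      integral_congr_ae hg.coeFn_toLp] at h0
    simpa using h0.symm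
  have hm := tendstoInMeasure_of_tendsto_Lp hlim
  refine (hm.congr_left fun n => birkhoffAverage_koopman_toLp hf hg n).congr_right ?_
  rw [← hc']
  exact hc

theorem empirical_real_apply (f : X → X) (n : ℕ) (x : X) {A : Set X} (hA : MeasurableSet A) :
    (empirical f n x).real A = birkhoffAverage ℝ f (A.indicator fun _ => (1 : ℝ)) n x := by
  classical
  simp only [empirical, measureReal_ennreal_smul_apply, birkhoffAverage, birkhoffSum, smul_eq_mul,
    ENNReal.toReal_inv, ENNReal.toReal_natCast]
  congr 1
  rw [Measure.real, Measure.finsetSum_apply, ENNReal.toReal_sum (by simp)]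
  refine Finset.sum_congr rfl fun i _ => ?_
  rw [Measure.dirac_apply' _ hA]
  by_cases h : f^[i] x ∈ A <;> simp [h]

theorem isProbabilityMeasure_empirical (f : X → X) {n : ℕ} (hn : n ≠ 0) (x : X) :
    IsProbabilityMeasure (empirical f n x) := by
  constructor
  simp only [empirical, Measure.smul_apply, Measure.finsetSum_apply, measure_univ,
    Finset.sum_const, Finset.card_range, smul_eq_mul, nsmul_eq_mul, mul_one]
  exact ENNReal.inv_mul_cancel (by exact_mod_cast hn) (by simp)

/-- The empirical measures of an ergodic measure `η` converge to `η` in `η`-measure, for any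
distance that is controlled by finite partitions: outside measurable sets `B n` of vanishing measure
the `n`-th empirical measure is close to `η`. -/
theorem exists_bad_sets {D : Measure X → Measure X → ℝ≥0∞} (hD : IsPartitionDist D)
    [IsProbabilityMeasure η] (hη : Ergodic f η) {δ : ℝ} (hδ : 0 < δ) :
    ∃ B : ℕ → Set X, (∀ n, MeasurableSet (B n)) ∧ Tendsto (fun n => η (B n)) atTop (𝓝 0) ∧
      ∀ n ≠ 0, ∀ x ∉ B n, D (empirical f n x) η ≤ ENNReal.ofReal δ := by
  obtain ⟨S, τ, hτ, hS, hSD⟩ := hD.approx δ hδ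
  let φ : Set X → ℕ → X → ℝ := fun A n => birkhoffAverage ℝ f (A.indicator fun _ => (1 : ℝ)) n
  have hφ : ∀ A ∈ S, ∀ n, Measurable (φ A n) := by
    intro A hA n
    have h1 : Measurable (A.indicator fun _ => (1 : ℝ)) := measurable_const.indicator (hS A hA)
    refine (Finset.measurable_fun_sum (Finset.range n) fun i _ => ?_).const_smul ((n : ℝ)⁻¹)
    exact h1.comp (hη.measurable.iterate i)
  refine ⟨fun n => ⋃ A ∈ S, {x | τ ≤ dist (φ A n x) (η.real A)}, fun n => ?_, ?_, ?_⟩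
  · exact Finset.measurableSet_biUnion _ fun A hA =>
      measurableSet_le measurable_const ((hφ A hA n).dist measurable_const)
  · have h0 : Tendsto (fun n => ∑ A ∈ S, η {x | τ ≤ dist (φ A n x) (η.real A)}) atTop (𝓝 0) := by
      rw [← Finset.sum_const_zero (s := S)]
      refine tendsto_finsetSum _ fun A hA => ?_
      have hg : MemLp (A.indicator fun _ => (1 : ℝ)) 2 η :=
        memLp_indicator_const 2 (hS A hA) 1 (Or.inr (measure_ne_top _ _))
      have := tendstoInMeasure_iff_dist.1 (tendstoInMeasure_birkhoffAverage hη hg) τ hτ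
      simpa [integral_indicator_const, hS A hA] using this
    exact tendsto_of_tendsto_of_tendsto_of_le_of_le tendsto_const_nhds h0 (fun _ => zero_le)
      fun n => measure_biUnion_finset_le _ _
  · intro n hn x hx
    have := isProbabilityMeasure_empirical f hn x
    refine hSD _ _ fun A hA => ?_
    rw [empirical_real_apply f n x (hS A hA), ← Real.dist_eq]
    have : x ∉ {x | τ ≤ dist (φ A n x) (η.real A)} := fun h => hx (Set.mem_biUnion hA h)
    exact (not_le.1 this).le
end

/-! ### Existence of ergodic measures -/

open scoped BoundedContinuousFunction

section
variable {X : Type*} [MetricSpace X] [MeasurableSpace X] [BorelSpace X]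

theorem continuous_integral_probabilityMeasure (g : X →ᵇ ℝ) :
    Continuous fun μ : ProbabilityMeasure X => ∫ x, g x ∂(μ : Measure X) :=
  continuous_iff_continuousAt.2 fun _ =>
    (ProbabilityMeasure.tendsto_iff_forall_integral_tendsto.1 tendsto_id) g

theorem isClosed_setOf_invariant {f : X → X} (hf : Continuous f) :
    IsClosed {μ : ProbabilityMeasure X | MeasurePreserving f (μ : Measure X) μ} := by
  have : {μ : ProbabilityMeasure X | MeasurePreserving f (μ : Measure X) μ} =
      {μ : ProbabilityMeasure X | μ.map hf.measurable.aemeasurable = μ} := by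
    ext μ
    constructor
    · intro h; exact Subtype.ext h.map_eq
    · intro h; exact ⟨hf.measurable, congrArg Subtype.val h⟩
  rw [this]
  exact isClosed_eq (ProbabilityMeasure.continuous_map hf) continuous_id

variable [CompactSpace X]

/-- **Krylov–Bogoliubov**: a continuous self-map of a nonempty compact metric space has an invariant
Borel probability measure. -/
theorem exists_invariant_probabilityMeasure [Nonempty X] {f : X → X} (hf : Continuous f) :
    ∃ μ : ProbabilityMeasure X, MeasurePreserving f (μ : Measure X) μ := by
  obtain ⟨x₀⟩ := ‹Nonempty X›
  let e : ℕ → ProbabilityMeasure X := fun n =>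
    ⟨empirical f (n + 1) x₀, isProbabilityMeasure_empirical f n.succ_ne_zero x₀⟩
  have hint : ∀ (g : X →ᵇ ℝ) (n : ℕ), ∫ x, g x ∂(e n : Measure X) =
      birkhoffAverage ℝ f g (n + 1) x₀ := by
    intro g n
    change ∫ x, g x ∂(empirical f (n + 1) x₀) = _
    rw [empirical, integral_smul_measure, integral_finsetSum_measure]
    · simp only [integral_dirac, birkhoffAverage, birkhoffSum, ENNReal.toReal_inv,
        ENNReal.toReal_natCast]
    · intro i _; exact g.integrable _
  -- a limit point of the empirical measures along an ultrafilter is invariant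
  let U : Ultrafilter ℕ := Ultrafilter.of atTop
  obtain ⟨μ, -, hμ⟩ := isCompact_univ.ultrafilter_le_nhds (U.map e) (by simp)
  have hU : Tendsto e U (𝓝 μ) := hμ
  refine ⟨μ, hf.measurable, ?_⟩
  have : IsProbabilityMeasure ((μ : Measure X).map f) :=
    Measure.isProbabilityMeasure_map hf.measurable.aemeasurable
  refine ext_of_forall_integral_eq_of_IsFiniteMeasure fun g => ?_
  rw [integral_map hf.measurable.aemeasurable g.continuous.aestronglyMeasurable]
  let gf : X →ᵇ ℝ := g.compContinuous ⟨f, hf⟩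
  have h1 := ((continuous_integral_probabilityMeasure gf).tendsto μ).comp hU
  have h2 := ((continuous_integral_probabilityMeasure g).tendsto μ).comp hU
  have h3 : Tendsto (fun n => ∫ x, gf x ∂(e n : Measure X) - ∫ x, g x ∂(e n : Measure X)) U
      (𝓝 0) := by
    refine Tendsto.mono_left ?_ (Ultrafilter.of_le atTop)
    have hb : Bornology.IsBounded (Set.range fun n => g (f^[n] x₀)) :=
      (isCompact_range g.continuous).isBounded.subset (by rintro _ ⟨n, rfl⟩; exact ⟨_, rfl⟩)
    have := (tendsto_birkhoffAverage_apply_sub_birkhoffAverage (𝕜 := ℝ) hb).comp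
      (tendsto_add_atTop_nat 1)
    refine this.congr fun n => ?_
    simp only [Function.comp_apply, hint]
    congr 1
    simp only [birkhoffAverage, birkhoffSum]
    congr 1
    refine Finset.sum_congr rfl fun i _ => ?_
    rw [← Function.iterate_succ_apply, Function.iterate_succ_apply']
    rfl
  exact sub_eq_zero.1 (tendsto_nhds_unique (h1.sub h2) h3)

/-- The invariant measures which maximize the integrals of `g 0, …, g (n - 1)` lexicographically. -/
def lexMaximizers (f : X → X) (g : ℕ → C(X, ℝ)) : ℕ → Set (ProbabilityMeasure X)
  | 0 => {μ | MeasurePreserving f (μ : Measure X) μ}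
  | n + 1 => {μ | μ ∈ lexMaximizers f g n ∧ ∀ ν ∈ lexMaximizers f g n,
      ∫ x, g n x ∂(ν : Measure X) ≤ ∫ x, g n x ∂(μ : Measure X)}

theorem isClosed_nonempty_lexMaximizers [Nonempty X] {f : X → X} (hf : Continuous f)
    (g : ℕ → C(X, ℝ)) (n : ℕ) :
    IsClosed (lexMaximizers f g n) ∧ (lexMaximizers f g n).Nonempty := by
  induction n with
  | zero => exact ⟨isClosed_setOf_invariant hf, exists_invariant_probabilityMeasure hf⟩
  | succ n ih =>
    have hc : Continuous fun μ : ProbabilityMeasure X => ∫ x, g n x ∂(μ : Measure X) :=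
      continuous_integral_probabilityMeasure (BoundedContinuousFunction.mkOfCompact (g n))
    refine ⟨?_, ?_⟩
    · simp only [lexMaximizers, Set.ofPred_and, Set.ofPred_forall]
      exact ih.1.inter (isClosed_biInter fun ν _ => isClosed_le continuous_const hc)
    · obtain ⟨μ, hμ, hmax⟩ := ih.1.isCompact.exists_isMaxOn ih.2 hc.continuousOn
      exact ⟨μ, hμ, hmax⟩

/-- A continuous self-map of a nonempty compact metric space has an ergodic measure: a measure that
lexicographically maximizes the integrals of a dense sequence of continuous functions among
the invariant measures is an extreme point of that set. -/
theorem exists_ergodic_probabilityMeasure [Nonempty X] {f : X → X} (hf : Continuous f) :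
    ∃ μ : ProbabilityMeasure X, Ergodic f (μ : Measure X) := by
  let g : ℕ → C(X, ℝ) := TopologicalSpace.denseSeq C(X, ℝ)
  have hK := isClosed_nonempty_lexMaximizers hf g
  obtain ⟨μ, hμ⟩ := IsCompact.nonempty_iInter_of_sequence_nonempty_isCompact_isClosed
    (lexMaximizers f g) (fun n μ h => h.1) (fun n => (hK n).2) (hK 0).1.isCompact
    (fun n => (hK n).1)
  rw [Set.mem_iInter] at hμ
  refine ⟨μ, Ergodic.of_mem_extremePoints ⟨⟨hμ 0, inferInstance⟩, ?_⟩⟩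
  rintro ν₁ ⟨hν₁, p₁⟩ ν₂ ⟨hν₂, p₂⟩ ⟨a, b, ha, hb, hab, habμ⟩
  have hint : ∀ (ν : Measure X) [IsProbabilityMeasure ν] (h : C(X, ℝ)), Integrable h ν :=
    fun ν _ h => (BoundedContinuousFunction.mkOfCompact h).integrable ν
  have ha' : a ≠ ∞ := by rintro rfl; simp at hab
  have hb' : b ≠ ∞ := by rintro rfl; simp at hab
  have habr : a.toReal + b.toReal = 1 := by
    rw [← ENNReal.toReal_add ha' hb', hab, ENNReal.toReal_one]
  have ha0 : 0 < a.toReal := ENNReal.toReal_pos ha.ne' ha'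
  have hb0 : 0 < b.toReal := ENNReal.toReal_pos hb.ne' hb'
  have hcomb : ∀ h : C(X, ℝ), ∫ x, h x ∂(μ : Measure X) =
      a.toReal * ∫ x, h x ∂ν₁ + b.toReal * ∫ x, h x ∂ν₂ := by
    intro h
    rw [← habμ, integral_add_measure ((hint ν₁ h).smul_measure ha')
      ((hint ν₂ h).smul_measure hb'), integral_smul_measure, integral_smul_measure]
    rfl
  let η₁ : ProbabilityMeasure X := ⟨ν₁, p₁⟩
  let η₂ : ProbabilityMeasure X := ⟨ν₂, p₂⟩
  -- the maximal value at `μ` is a convex combination of the values at the components, so it is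
  -- attained at both
  have hstep : ∀ n, η₁ ∈ lexMaximizers f g n → η₂ ∈ lexMaximizers f g n →
      ∫ x, g n x ∂ν₁ = ∫ x, g n x ∂(μ : Measure X) ∧
      ∫ x, g n x ∂ν₂ = ∫ x, g n x ∂(μ : Measure X) := by
    intro n h₁ h₂
    have m₁ : ∫ x, g n x ∂ν₁ ≤ ∫ x, g n x ∂(μ : Measure X) := (hμ (n + 1)).2 η₁ h₁
    have m₂ : ∫ x, g n x ∂ν₂ ≤ ∫ x, g n x ∂(μ : Measure X) := (hμ (n + 1)).2 η₂ h₂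
    have hc := hcomb (g n)
    have hsum : a.toReal * (∫ x, g n x ∂(μ : Measure X) - ∫ x, g n x ∂ν₁) +
        b.toReal * (∫ x, g n x ∂(μ : Measure X) - ∫ x, g n x ∂ν₂) = 0 := by
      linear_combination (∫ x, g n x ∂(μ : Measure X)) * habr + hc
    have n₁ := mul_nonneg ha0.le (sub_nonneg.2 m₁)
    have n₂ := mul_nonneg hb0.le (sub_nonneg.2 m₂)
    obtain ⟨z₁, z₂⟩ := (add_eq_zero_iff_of_nonneg n₁ n₂).1 hsum
    exact ⟨(sub_eq_zero.1 ((mul_eq_zero.1 z₁).resolve_left ha0.ne')).symm,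
      (sub_eq_zero.1 ((mul_eq_zero.1 z₂).resolve_left hb0.ne')).symm⟩
  have hmem : ∀ n, η₁ ∈ lexMaximizers f g n ∧ η₂ ∈ lexMaximizers f g n := by
    intro n
    induction n with
    | zero => exact ⟨hν₁, hν₂⟩
    | succ n ih =>
      obtain ⟨e₁, e₂⟩ := hstep n ih.1 ih.2
      exact ⟨⟨ih.1, fun ν hν => ((hμ (n + 1)).2 ν hν).trans_eq e₁.symm⟩,
        ⟨ih.2, fun ν hν => ((hμ (n + 1)).2 ν hν).trans_eq e₂.symm⟩⟩
  have hcont : ∀ (ν : Measure X) [IsProbabilityMeasure ν],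
      Continuous fun h : C(X, ℝ) => ∫ x, h x ∂ν := by
    intro ν _
    refine (LipschitzWith.of_dist_le_mul (K := 1) fun h₁ h₂ => ?_).continuous
    rw [dist_eq_norm, ← integral_sub (hint ν h₁) (hint ν h₂)]
    refine (norm_integral_le_of_norm_le_const (C := dist h₁ h₂) ?_).trans (by simp)
    exact Eventually.of_forall fun x => by
      rw [← dist_eq_norm]; exact ContinuousMap.dist_apply_le_dist x
  have hall : ∀ h : C(X, ℝ), ∫ x, h x ∂ν₁ = ∫ x, h x ∂(μ : Measure X) := by
    have := Continuous.ext_on (TopologicalSpace.denseRange_denseSeq C(X, ℝ)) (hcont ν₁)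
      (hcont (μ : Measure X)) (by
        rintro _ ⟨n, rfl⟩
        exact (hstep n (hmem n).1 (hmem n).2).1)
    exact fun h => congrFun this h
  exact ext_of_forall_integral_eq_of_IsFiniteMeasure fun h => hall h.toContinuousMap
end

/-! ### Emergence of a countable mixture of ergodic measures -/

section
variable {X : Type*} [MeasurableSpace X] {D : Measure X → Measure X → ℝ≥0∞} {f : X → X}

/-- The distance from `η` to the finite set of centres `F`, with value `∞` for empty `F`. -/
noncomputable def infDistTo (D : Measure X → Measure X → ℝ≥0∞) (F : Finset (ProbabilityMeasure X))
    (η : Measure X) : ℝ≥0∞ :=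
  ⨅ ν ∈ F, D η (ν : Measure X)

theorem infDistTo_le_add (hD : IsPartitionDist D) (F : Finset (ProbabilityMeasure X))
    (μ ν : Measure X) [IsProbabilityMeasure μ] [IsProbabilityMeasure ν] :
    infDistTo D F μ ≤ D μ ν + infDistTo D F ν := by
  simp only [infDistTo, ENNReal.add_iInf]
  exact le_iInf₂ fun κ hκ => (iInf₂_le κ hκ).trans (hD.triangle μ ν κ)

/-- The integrand need not be measurable; the lower integral is squeezed between integrals of
measurable functions, which differ little from the constant `infDistTo D F η` off the bad sets. -/
theorem tendsto_lintegral_infDistTo (hD : IsPartitionDist D) {η : Measure X}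
    [IsProbabilityMeasure η] (hη : Ergodic f η) {F : Finset (ProbabilityMeasure X)}
    (hF : F.Nonempty) :
    Tendsto (fun n => ∫⁻ x, infDistTo D F (empirical f n x) ∂η) atTop (𝓝 (infDistTo D F η)) := by
  obtain ⟨C, hC, hDC⟩ := hD.bounded
  have hle : ∀ (μ : Measure X) [IsProbabilityMeasure μ], infDistTo D F μ ≤ C := by
    intro μ _
    obtain ⟨ν, hν⟩ := hF
    exact (iInf₂_le ν hν).trans (hDC μ ν)
  rw [ENNReal.tendsto_nhds ((hle η).trans_lt hC.lt_top).ne]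
  intro ε hε
  obtain ⟨δ, hδ0, hδε⟩ : ∃ δ : ℝ, 0 < δ ∧ ENNReal.ofReal δ ≤ ε / 2 := by
    obtain ⟨r, hr0, hr⟩ := ENNReal.lt_iff_exists_nnreal_btwn.1 (ENNReal.half_pos hε.ne')
    exact ⟨r, by simpa using hr0, by simpa using hr.le⟩
  obtain ⟨B, hBm, hB0, hB⟩ := exists_bad_sets hD hη hδ0
  have hsmall : ∀ᶠ n in atTop, C * η (B n) ≤ ε / 2 := by
    have : Tendsto (fun n => C * η (B n)) atTop (𝓝 (C * 0)) :=
      ENNReal.Tendsto.const_mul hB0 (Or.inr hC)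
    rw [mul_zero] at this
    exact this.eventually_le_const (ENNReal.half_pos hε.ne')
  have herr : ∀ n, ∀ φ : X → ℝ≥0∞,
      ∫⁻ x, (φ x + (ENNReal.ofReal δ + (B n).indicator (fun _ => C) x)) ∂η =
        ∫⁻ x, φ x ∂η + (ENNReal.ofReal δ + C * η (B n)) := by
    intro n φ
    have hm : Measurable ((B n).indicator fun _ => C) := measurable_const.indicator (hBm n)
    have hm' : Measurable fun x => ENNReal.ofReal δ + (B n).indicator (fun _ => C) x :=
      measurable_const.add hm
    rw [lintegral_add_right _ hm', lintegral_add_right _ hm,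
      lintegral_const, measure_univ, mul_one, lintegral_indicator_const (hBm n)]
  have hfin : ∀ n, C * η (B n) ≤ ε / 2 → ENNReal.ofReal δ + C * η (B n) ≤ ε := by
    intro n h
    calc _ ≤ ε / 2 + ε / 2 := add_le_add hδε h
      _ = ε := ENNReal.add_halves ε
  filter_upwards [hsmall, eventually_ne_atTop 0] with n hn hn0
  have hclose : ∀ x, infDistTo D F η ≤ infDistTo D F (empirical f n x) +
        (ENNReal.ofReal δ + (B n).indicator (fun _ => C) x) ∧
      infDistTo D F (empirical f n x) ≤ infDistTo D F η +
        (ENNReal.ofReal δ + (B n).indicator (fun _ => C) x) := by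
    intro x
    have := isProbabilityMeasure_empirical f hn0 x
    by_cases hx : x ∈ B n
    · simp only [Set.indicator_of_mem hx]
      exact ⟨(hle η).trans (le_add_left (le_add_left le_rfl)),
        (hle _).trans (le_add_left (le_add_left le_rfl))⟩
    · simp only [Set.indicator_of_notMem hx, add_zero]
      have h1 := hB n hn0 x hx
      constructor
      · refine (infDistTo_le_add hD F η (empirical f n x)).trans ?_
        rw [hD.symm, add_comm]; gcongr
      · refine (infDistTo_le_add hD F (empirical f n x) η).trans ?_
        rw [add_comm]; gcongr
  constructor
  · rw [tsub_le_iff_right]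
    calc infDistTo D F η = ∫⁻ _, infDistTo D F η ∂η := by simp
      _ ≤ _ := lintegral_mono fun x => (hclose x).1
      _ = _ := herr n _
      _ ≤ _ := by gcongr; exact hfin n hn
  · calc _ ≤ _ := lintegral_mono fun x => (hclose x).2
      _ = _ := herr n _
      _ ≤ _ := by rw [lintegral_const, measure_univ, mul_one]; gcongr; exact hfin n hn

/-- For a convex combination `∑ c i • η i` of ergodic measures, the limit superior in the definition
of metric emergence is the average distance of the components `η i` to the centres. -/
theorem limsup_lintegral_infDistTo_sum (hD : IsPartitionDist D) {ι : Type*} {c : ι → ℝ≥0∞}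
    (hc : ∑' i, c i = 1) {η : ι → Measure X} [∀ i, IsProbabilityMeasure (η i)]
    (hη : ∀ i, Ergodic f (η i)) {F : Finset (ProbabilityMeasure X)} (hF : F.Nonempty) :
    limsup (fun n => ∫⁻ x, infDistTo D F (empirical f n x) ∂(Measure.sum fun i => c i • η i)) atTop
      = ∑' i, c i * infDistTo D F (η i) := by
  obtain ⟨C, hC, hDC⟩ := hD.bounded
  have hle : ∀ (μ : Measure X) [IsProbabilityMeasure μ], infDistTo D F μ ≤ C := by
    intro μ _
    obtain ⟨ν, hν⟩ := hF
    exact (iInf₂_le ν hν).trans (hDC μ ν)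
  refine Tendsto.limsup_eq ?_
  simp only [lintegral_sum_measure, lintegral_smul_measure, smul_eq_mul]
  -- dominated convergence for the counting measure on the index set
  let _ : MeasurableSpace ι := ⊤
  have : DiscreteMeasurableSpace ι := ⟨fun _ => trivial⟩
  simp only [← lintegral_count]
  have hc' : ∀ i, c i ≠ ∞ := fun i h => by
    have := ENNReal.le_tsum (f := c) i
    rw [hc, h] at this
    exact absurd this (by simp)
  refine tendsto_lintegral_filter_of_dominated_convergence (fun i => c i * C)
    (Eventually.of_forall fun n => Measurable.of_discrete) ?_ ?_ ?_
  · filter_upwards [eventually_ne_atTop 0] with n hn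
    refine Eventually.of_forall fun i => ?_
    gcongr
    refine (lintegral_mono (g := fun _ => C) fun x => ?_).trans (by simp)
    have := isProbabilityMeasure_empirical f hn x
    exact hle _
  · rw [lintegral_count, ENNReal.tsum_mul_right, hc, one_mul]; exact hC
  · exact Eventually.of_forall fun i =>
      ENNReal.Tendsto.const_mul (tendsto_lintegral_infDistTo hD (hη i) hF) (Or.inr (hc' i))

theorem isProbabilityMeasure_sum_smul {ι : Type*} {c : ι → ℝ≥0∞}
    (hc : ∑' i, c i = 1) (η : ι → Measure X) [∀ i, IsProbabilityMeasure (η i)] :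
    IsProbabilityMeasure (Measure.sum fun i => c i • η i) :=
  ⟨by simp [Measure.sum_apply _ MeasurableSet.univ, hc]⟩

theorem measurePreserving_sum_smul (hf : Measurable f) {ι : Type*} (c : ι → ℝ≥0∞)
    {η : ι → Measure X} (hη : ∀ i, MeasurePreserving f (η i) (η i)) :
    MeasurePreserving f (Measure.sum fun i => c i • η i) (Measure.sum fun i => c i • η i) := by
  refine ⟨hf, ?_⟩
  ext s hs
  rw [Measure.map_apply hf hs, Measure.sum_apply _ (hf hs), Measure.sum_apply _ hs]
  simp only [Measure.smul_apply, (hη _).measure_preimage hs.nullMeasurableSet]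

/-- The condition on `F` in the definition of metric emergence, for a convex combination of ergodic
measures. The empty family fails it, because its infimum is `∞`. -/
theorem limsup_lintegral_le_iff (hD : IsPartitionDist D) {ι : Type*} {c : ι → ℝ≥0∞}
    (hc : ∑' i, c i = 1) {η : ι → Measure X} [∀ i, IsProbabilityMeasure (η i)]
    (hη : ∀ i, Ergodic f (η i)) {F : Finset (ProbabilityMeasure X)} {ε : ℝ} :
    limsup (fun n : ℕ => ∫⁻ x, ⨅ ν ∈ F, D (empirical f n x) (ν : Measure X)
        ∂(Measure.sum fun i => c i • η i)) atTop ≤ ENNReal.ofReal ε ↔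
      F.Nonempty ∧ ∑' i, c i * infDistTo D F (η i) ≤ ENNReal.ofReal ε := by
  rcases F.eq_empty_or_nonempty with rfl | hF
  · have := isProbabilityMeasure_sum_smul hc η
    simp
  · rw [← limsup_lintegral_infDistTo_sum hD hc hη hF]
    simp [hF, infDistTo]

theorem metricEmergence_le_topologicalEmergence (hD : IsPartitionDist D) {ι : Type*}
    {c : ι → ℝ≥0∞} (hc : ∑' i, c i = 1) {η : ι → Measure X} [∀ i, IsProbabilityMeasure (η i)]
    (hη : ∀ i, Ergodic f (η i)) (ε : ℝ) :
    metricEmergence D f (Measure.sum fun i => c i • η i) ε ≤ topologicalEmergence D f ε := by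
  have hι : Nonempty ι := by
    by_contra h
    rw [not_nonempty_iff] at h
    simp at hc
  refine le_iInf₂ fun F hF => iInf₂_le F ((limsup_lintegral_le_iff hD hc hη).2 ⟨?_, ?_⟩)
  · obtain ⟨i⟩ := hι
    obtain ⟨ν, hν, -⟩ := hF ⟨η i, inferInstance⟩ (hη i)
    exact ⟨ν, hν⟩
  · calc ∑' i, c i * infDistTo D F (η i) ≤ ∑' i, c i * ENNReal.ofReal ε := by
          gcongr with i
          obtain ⟨ν, hν, h⟩ := hF ⟨η i, inferInstance⟩ (hη i)
          exact (iInf₂_le ν hν).trans h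
      _ = ENNReal.ofReal ε := by rw [ENNReal.tsum_mul_right, hc, one_mul]

theorem topologicalEmergence_antitone (D : Measure X → Measure X → ℝ≥0∞) (f : X → X) :
    Antitone (topologicalEmergence D f) := fun _ _ h =>
  le_iInf₂ fun F hF => iInf₂_le F fun η hη =>
    let ⟨ν, hν, hle⟩ := hF η hη
    ⟨ν, hν, hle.trans (ENNReal.ofReal_le_ofReal h)⟩

end

/-! ### Separated sets of ergodic measures -/

section
variable {X : Type*} [MeasurableSpace X] {D : Measure X → Measure X → ℝ≥0∞} {f : X → X}

/-- Measures whose masses on the cells of a fine partition round to the same multiples of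
the tolerance are close, so the size of a separated set is bounded. -/
theorem exists_card_le_of_separated (hD : IsPartitionDist D) {δ : ℝ} (hδ : 0 < δ) :
    ∃ N : ℕ, ∀ S : Finset (ProbabilityMeasure X),
      (∀ μ ∈ S, ∀ ν ∈ S, μ ≠ ν → ENNReal.ofReal δ < D (μ : Measure X) ν) → S.card ≤ N := by
  classical
  obtain ⟨T, τ, hτ, -, hT⟩ := hD.approx δ hδ
  let r : ProbabilityMeasure X → (T → Fin (⌊1 / τ⌋₊ + 1)) := fun μ A =>
    ⟨⌊(μ : Measure X).real A / τ⌋₊, Nat.lt_succ_of_le (Nat.floor_mono (by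
      gcongr; exact measureReal_le_one))⟩
  refine ⟨Fintype.card (T → Fin (⌊1 / τ⌋₊ + 1)), fun S hS => ?_⟩
  rw [← Finset.card_univ]
  refine Finset.card_le_card_of_injOn r (fun _ _ => Finset.mem_univ _) fun μ hμ ν hν h => ?_
  by_contra hne
  refine (hS μ hμ ν hν hne).not_ge (hT _ _ fun A hA => ?_)
  have hA' : ⌊(μ : Measure X).real A / τ⌋₊ = ⌊(ν : Measure X).real A / τ⌋₊ :=
    congrArg Fin.val (congrFun h ⟨A, hA⟩)
  have h1 := Nat.floor_le (div_nonneg (measureReal_nonneg (μ := (μ : Measure X)) (s := A)) hτ.le)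
  have h2 := Nat.lt_floor_add_one ((μ : Measure X).real A / τ)
  have h3 := Nat.floor_le (div_nonneg (measureReal_nonneg (μ := (ν : Measure X)) (s := A)) hτ.le)
  have h4 := Nat.lt_floor_add_one ((ν : Measure X).real A / τ)
  rw [hA'] at h1 h2
  rw [le_div_iff₀ hτ] at h1 h3
  rw [div_lt_iff₀ hτ] at h2 h4
  rw [abs_le]
  constructor <;> linarith

/-- A separated subset of `P` of maximal cardinality is a net for `P`. -/
theorem exists_maximal_separated (hD : IsPartitionDist D) {P : Set (ProbabilityMeasure X)}
    (hP : P.Nonempty) {δ : ℝ} (hδ : 0 < δ) :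
    ∃ S : Finset (ProbabilityMeasure X), S.Nonempty ∧ (∀ μ ∈ S, μ ∈ P) ∧
      (∀ μ ∈ S, ∀ ν ∈ S, μ ≠ ν → ENNReal.ofReal δ < D (μ : Measure X) ν) ∧
      ∀ η ∈ P, ∃ ν ∈ S, D (η : Measure X) ν ≤ ENNReal.ofReal δ := by
  classical
  obtain ⟨N, hN⟩ := exists_card_le_of_separated hD hδ
  let Q : Set ℕ := {n | ∃ S : Finset (ProbabilityMeasure X), (∀ μ ∈ S, μ ∈ P) ∧
    (∀ μ ∈ S, ∀ ν ∈ S, μ ≠ ν → ENNReal.ofReal δ < D (μ : Measure X) ν) ∧ S.card = n}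
  have hQb : BddAbove Q := ⟨N, by rintro _ ⟨S, -, hS, rfl⟩; exact hN S hS⟩
  obtain ⟨S, hSP, hS, hcard⟩ : sSup Q ∈ Q := Nat.sSup_mem ⟨0, ∅, by simp⟩ hQb
  have hcov : ∀ η ∈ P, ∃ ν ∈ S, D (η : Measure X) ν ≤ ENNReal.ofReal δ := by
    intro η hη
    by_contra! hfar
    have hself : D (η : Measure X) η ≤ ENNReal.ofReal δ := by
      obtain ⟨T, τ, hτ, -, hT⟩ := hD.approx δ hδ
      exact hT _ _ fun A _ => by simpa using hτ.le
    have hmem : η ∉ S := fun h => (hfar η h).not_ge hself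
    have : S.card + 1 ∈ Q := by
      refine ⟨insert η S, ?_, ?_, Finset.card_insert_of_notMem hmem⟩
      · simpa [hη] using hSP
      · intro μ hμ ν hν hne
        rcases Finset.mem_insert.1 hμ with rfl | hμ' <;>
          rcases Finset.mem_insert.1 hν with rfl | hν'
        · exact absurd rfl hne
        · exact hfar ν hν'
        · rw [hD.symm]; exact hfar μ hμ'
        · exact hS μ hμ' ν hν' hne
    have := le_csSup hQb this
    omega
  refine ⟨S, ?_, hSP, hS, hcov⟩
  obtain ⟨η, hη⟩ := hP
  obtain ⟨ν, hν, -⟩ := hcov η hη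
  exact ⟨ν, hν⟩

/-- If the average distance from a separated set `S` to the centres `F` is small, then `F` has more
than half as many points as `S`: each centre is close to at most one point of `S`. -/
theorem card_lt_of_sum_infDistTo_le (hD : IsPartitionDist D) {δ : ℝ} {a t : ℝ≥0∞}
    {S F : Finset (ProbabilityMeasure X)} (hS0 : S.Nonempty)
    (hS : ∀ μ ∈ S, ∀ ν ∈ S, μ ≠ ν → ENNReal.ofReal δ < D (μ : Measure X) ν)
    (hle : ∑ η ∈ S, a / S.card * infDistTo D F (η : Measure X) ≤ t)
    (ht : 2 * t < a * ENNReal.ofReal (δ / 2)) : S.card < 2 * F.card := by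
  classical
  by_contra! hcard
  set d := ENNReal.ofReal (δ / 2)
  have hδ : ENNReal.ofReal δ = d + d := by
    have : 0 < δ / 2 := by
      by_contra! h
      simp [d, ENNReal.ofReal_of_nonpos h] at ht
    rw [← ENNReal.ofReal_add this.le this.le, add_halves]
  let far := S.filter fun η : ProbabilityMeasure X => d ≤ infDistTo D F (η : Measure X)
  let near := S.filter fun η : ProbabilityMeasure X => ¬ d ≤ infDistTo D F (η : Measure X)
  have hnear : near.card ≤ F.card := by
    have hex : ∀ η ∈ near, ∃ ν ∈ F, D (η : Measure X) (ν : Measure X) < d := by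
      intro η hη
      have := not_le.1 (Finset.mem_filter.1 hη).2
      simpa only [infDistTo, iInf_lt_iff, exists_prop] using this
    have : Nonempty (ProbabilityMeasure X) := ⟨hS0.choose⟩
    choose! φ hφF hφ using hex
    refine Finset.card_le_card_of_injOn φ hφF fun η hη η' hη' h => ?_
    by_contra hne
    refine (hS η (Finset.mem_filter.1 hη).1 η' (Finset.mem_filter.1 hη').1 hne).not_ge ?_
    rw [hδ]
    refine (hD.triangle _ (φ η : Measure X) _).trans (add_le_add (hφ η hη).le ?_)
    rw [hD.symm, h]
    exact (hφ η' hη').le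
  have hsplit : far.card + near.card = S.card := Finset.card_filter_add_card_filter_not _
  have hfar : (S.card : ℝ≥0∞) ≤ 2 * far.card := by
    have : S.card ≤ 2 * far.card := by omega
    exact_mod_cast this
  have hS0' : (S.card : ℝ≥0∞) ≠ 0 := by simpa using hS0.ne_empty
  refine ht.not_ge ?_
  calc a * d = S.card * (a / S.card) * d := by
        rw [ENNReal.mul_div_cancel hS0' (ENNReal.natCast_ne_top _)]
    _ ≤ 2 * far.card * (a / S.card) * d := by gcongr
    _ = 2 * ∑ η ∈ far, a / S.card * d := by
        rw [Finset.sum_const, nsmul_eq_mul]; ring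
    _ ≤ 2 * ∑ η ∈ far, a / S.card * infDistTo D F (η : Measure X) := by
        gcongr with η hη
        exact (Finset.mem_filter.1 hη).2
    _ ≤ 2 * ∑ η ∈ S, a / S.card * infDistTo D F (η : Measure X) := by
        gcongr
        exact Finset.filter_subset _ _
    _ ≤ 2 * t := by gcongr

/-- If ergodic measures exist, some invariant measure has a metric emergence that is comparable
with the topological emergence at the scales `2 ^ (-j ^ 2)`. -/
theorem exists_invariant_metricEmergence (hD : IsPartitionDist D) (hf : Measurable f)
    (hne : ∃ η : ProbabilityMeasure X, Ergodic f (η : Measure X)) :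
    ∃ μ : Measure X, IsProbabilityMeasure μ ∧ MeasurePreserving f μ μ ∧
      (∀ ε, metricEmergence D f μ ε ≤ topologicalEmergence D f ε) ∧
      ∀ (j : ℕ) (ε : ℝ), ε < (1 / 2) ^ (j + 1) * (1 / 2) ^ (j ^ 2) / 4 →
        topologicalEmergence D f ((1 / 2) ^ (j ^ 2)) ≤ metricEmergence D f μ ε ^ 2 := by
  choose S hS0 hSerg hSsep hScov using fun j : ℕ =>
    exists_maximal_separated hD (P := {η | Ergodic f (η : Measure X)}) hne
      (δ := (1 / 2) ^ (j ^ 2)) (by positivity)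
  let c : (Σ j, S j) → ℝ≥0∞ := fun i => (1 / 2) ^ (i.1 + 1) / (S i.1).card
  let η : (Σ j, S j) → Measure X := fun i => ((i.2 : ProbabilityMeasure X) : Measure X)
  have : ∀ i, IsProbabilityMeasure (η i) := fun i => inferInstance
  have hη : ∀ i, Ergodic f (η i) := fun i => hSerg i.1 _ i.2.2
  have hc : ∑' i, c i = 1 := by
    rw [ENNReal.tsum_sigma']
    have : ∀ j, ∑' η : S j, c ⟨j, η⟩ = (1 / 2) ^ (j + 1) := by
      intro j
      have h0 : ((S j).card : ℝ≥0∞) ≠ 0 := by simpa using (hS0 j).ne_empty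
      simp only [c, tsum_fintype, Finset.sum_const, Finset.card_univ, Fintype.card_coe,
        nsmul_eq_mul]
      exact ENNReal.mul_div_cancel h0 (ENNReal.natCast_ne_top _)
    simp only [this]
    rw [ENNReal.tsum_geometric_add_one, one_div, ENNReal.one_sub_inv_two, inv_inv,
      ENNReal.inv_mul_cancel (by simp) (by simp)]
  refine ⟨Measure.sum fun i => c i • η i, isProbabilityMeasure_sum_smul hc η,
    measurePreserving_sum_smul hf c fun i => (hη i).toMeasurePreserving,
    metricEmergence_le_topologicalEmergence hD hc hη, fun j ε hε => ?_⟩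
  set m := metricEmergence D f (Measure.sum fun i => c i • η i) ε with hm
  rcases eq_or_ne m ⊤ with htop | htop
  · rw [htop]; simp
  -- an optimal set of centres
  obtain ⟨F, hF, hFm⟩ : ∃ F : Finset (ProbabilityMeasure X), (F.Nonempty ∧
      ∑' i, c i * infDistTo D F (η i) ≤ ENNReal.ofReal ε) ∧ (F.card : ℕ∞) ≤ m := by
    have hlt : m < m + 1 := ENat.lt_add_one_iff htop |>.2 le_rfl
    conv_lhs at hlt => rw [hm, metricEmergence]
    simp only [iInf_lt_iff] at hlt
    obtain ⟨F, hF, hFm⟩ := hlt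
    exact ⟨F, (limsup_lintegral_le_iff hD hc hη).1 hF, (ENat.lt_add_one_iff htop).1 hFm⟩
  have hsum : ∑ ν ∈ S j, (1 / 2) ^ (j + 1) / ((S j).card : ℝ≥0∞) * infDistTo D F (ν : Measure X)
      ≤ ENNReal.ofReal ε := by
    refine le_trans ?_ hF.2
    rw [ENNReal.tsum_sigma']
    refine le_trans ?_ (ENNReal.le_tsum j)
    rw [tsum_fintype, ← Finset.sum_coe_sort]
  have hcard : (S j).card < 2 * F.card := by
    refine card_lt_of_sum_infDistTo_le hD (hS0 j) (hSsep j) hsum ?_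
    have h2 : (1 / 2 : ℝ≥0∞) = ENNReal.ofReal (1 / 2) := by
      rw [ENNReal.ofReal_div_of_pos two_pos]; simp
    rw [h2, ← ENNReal.ofReal_pow (by norm_num), ← ENNReal.ofReal_mul (by positivity),
      ← ENNReal.ofReal_ofNat, ← ENNReal.ofReal_mul (by positivity),
      ENNReal.ofReal_lt_ofReal_iff (by positivity)]
    linarith
  -- `F` is nonempty, so `2 * #F - 1 ≤ (#F) ^ 2`
  have hsq : (S j).card ≤ F.card ^ 2 := by
    have := hF.1.card_pos
    nlinarith [sq_nonneg ((F.card : ℤ) - 1)]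
  calc topologicalEmergence D f ((1 / 2) ^ (j ^ 2)) ≤ (S j).card :=
        iInf₂_le (S j) fun ν hν => hScov j ν hν
    _ ≤ (F.card : ℕ∞) ^ 2 := by exact_mod_cast hsq
    _ ≤ m ^ 2 := by gcongr
end

/-! ### Iterated logarithms and the limits -/

/-- The iterated logarithm `log log N`, the numerator of `logLogRatio`. -/
noncomputable def logLog (N : ℕ∞) : EReal :=
  ENNReal.log (ENNReal.log (N : ℝ≥0∞)).toENNReal

theorem logLog_mono : Monotone logLog := fun M N h =>
  ENNReal.log_monotone (EReal.toENNReal_le_toENNReal (ENNReal.log_monotone (by exact_mod_cast h)))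

theorem logLog_sq (N : ℕ∞) : logLog (N ^ 2) = (Real.log 2 : ℝ) + logLog N := by
  have h2 : ENNReal.log ((N ^ 2 : ℕ∞) : ℝ≥0∞) = 2 * ENNReal.log (N : ℝ≥0∞) := by
    rw [ENat.toENNReal_pow, ENNReal.log_pow]; rfl
  rw [logLog, h2, EReal.toENNReal_mul (by norm_num), ENNReal.log_mul_add, logLog]
  congr 1
  rw [show (2 : EReal) = ((2 : ℝ) : EReal) from rfl, EReal.real_coe_toENNReal,
    ENNReal.log_ofReal_of_pos two_pos]

theorem logLogRatio_lt_iff {N : ℕ∞} {ε : ℝ} (h0 : 0 < ε) (h1 : ε < 1) {c : ℝ} :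
    logLogRatio N ε < c ↔ logLog N < ((c * (-Real.log ε) : ℝ) : EReal) := by
  have := Real.log_neg h0 h1
  rw [logLogRatio, EReal.div_lt_iff (by exact_mod_cast (by linarith)) (by simp), EReal.coe_mul]
  rfl

theorem logLogRatio_mono {M N : ℕ∞} (h : M ≤ N) {ε : ℝ} (h0 : 0 < ε) (h1 : ε < 1) :
    logLogRatio M ε ≤ logLogRatio N ε := by
  have := Real.log_neg h0 h1
  exact EReal.div_le_div_right_of_nonneg (by exact_mod_cast (by linarith)) (logLog_mono h)

theorem tendsto_rpow_nhdsGT_zero {s : ℝ} (hs : 0 < s) :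
    Tendsto (fun ε : ℝ => ε ^ s) (𝓝[>] 0) (𝓝[>] 0) := by
  refine tendsto_nhdsWithin_iff.2 ⟨?_, ?_⟩
  · have := (Real.continuousAt_rpow_const 0 s (Or.inr hs.le)).tendsto
    rw [Real.zero_rpow hs.ne'] at this
    exact this.mono_left nhdsWithin_le_nhds
  · filter_upwards [self_mem_nhdsWithin] with ε hε
    exact Real.rpow_pos_of_pos hε s

/-- The comparison `B ε ≤ A (ε ^ (1 + s)) ^ 2` for every `s > 0` transfers upper bounds of
the quotients: the square costs `log 2 / (-log ε) → 0`, the exponent the factor `1 + s`. -/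
theorem exists_eventually_logLogRatio_lt {A B : ℝ → ℕ∞}
    (h : ∀ s : ℝ, 0 < s → ∀ᶠ ε in 𝓝[>] (0 : ℝ), B ε ≤ A (ε ^ (1 + s)) ^ 2) {c' c : ℝ}
    (hc : c' < c) : ∃ s : ℝ, 0 < s ∧ ∀ᶠ ε in 𝓝[>] (0 : ℝ),
      logLogRatio (A (ε ^ (1 + s))) (ε ^ (1 + s)) < c' → logLogRatio (B ε) ε < c := by
  obtain ⟨s, hs, hsc⟩ : ∃ s : ℝ, 0 < s ∧ (1 + s) * c' < c := by
    refine ⟨(c - c') / (2 * (|c'| + 1)), by have := abs_nonneg c'; apply div_pos <;> linarith, ?_⟩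
    have h1 : (c - c') / (2 * (|c'| + 1)) * c' ≤ (c - c') / (2 * (|c'| + 1)) * (|c'| + 1) := by
      have := abs_nonneg c'
      refine mul_le_mul_of_nonneg_left ?_ (by apply div_nonneg <;> linarith)
      linarith [le_abs_self c']
    have h2 : (c - c') / (2 * (|c'| + 1)) * (|c'| + 1) = (c - c') / 2 := by
      have : |c'| + 1 ≠ 0 := by positivity
      field_simp
    linarith
  refine ⟨s, hs, ?_⟩
  have hlog : ∀ᶠ ε in 𝓝[>] (0 : ℝ), Real.log 2 / (c - (1 + s) * c') < -Real.log ε :=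
    (tendsto_neg_atBot_atTop.comp Real.tendsto_log_nhdsGT_zero).eventually_gt_atTop _
  have h01 : ∀ᶠ ε in 𝓝[>] (0 : ℝ), ε ∈ Set.Ioo (0 : ℝ) 1 := Ioo_mem_nhdsGT one_pos
  filter_upwards [h s hs, hlog, h01] with ε hBA hl ⟨h0, h1⟩ hA
  have hε0 : 0 < ε ^ (1 + s) := Real.rpow_pos_of_pos h0 _
  have hε1 : ε ^ (1 + s) < 1 := Real.rpow_lt_one h0.le h1 (by linarith)
  rw [logLogRatio_lt_iff hε0 hε1, Real.log_rpow h0] at hA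
  rw [logLogRatio_lt_iff h0 h1]
  rw [div_lt_iff₀ (by linarith)] at hl
  calc logLog (B ε) ≤ (Real.log 2 : ℝ) + logLog (A (ε ^ (1 + s))) :=
        (logLog_mono hBA).trans_eq (logLog_sq _)
    _ < ((Real.log 2 : ℝ) : EReal) + ((c' * (-((1 + s) * Real.log ε)) : ℝ) : EReal) :=
        EReal.add_lt_add_left_coe hA _
    _ ≤ ((c * (-Real.log ε) : ℝ) : EReal) := by
        rw [← EReal.coe_add]
        exact_mod_cast (by linarith)

theorem limsup_liminf_logLogRatio_eq {A B : ℝ → ℕ∞} (hle : ∀ ε, A ε ≤ B ε)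
    (h : ∀ s : ℝ, 0 < s → ∀ᶠ ε in 𝓝[>] (0 : ℝ), B ε ≤ A (ε ^ (1 + s)) ^ 2) :
    limsup (fun ε : ℝ => logLogRatio (A ε) ε) (𝓝[>] 0) =
      limsup (fun ε : ℝ => logLogRatio (B ε) ε) (𝓝[>] 0) ∧
    liminf (fun ε : ℝ => logLogRatio (A ε) ε) (𝓝[>] 0) =
      liminf (fun ε : ℝ => logLogRatio (B ε) ε) (𝓝[>] 0) := by
  have h01 : ∀ᶠ ε in 𝓝[>] (0 : ℝ), ε ∈ Set.Ioo (0 : ℝ) 1 := Ioo_mem_nhdsGT one_pos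
  have hAB : ∀ᶠ ε in 𝓝[>] (0 : ℝ), logLogRatio (A ε) ε ≤ logLogRatio (B ε) ε := by
    filter_upwards [h01] with ε hε
    exact logLogRatio_mono (hle ε) hε.1 hε.2
  refine ⟨le_antisymm (limsup_le_limsup hAB) ?_, le_antisymm (liminf_le_liminf hAB) ?_⟩
  · refine EReal.le_of_forall_lt_iff_le.1 fun c hlt => ?_
    obtain ⟨c', h1, h2⟩ := EReal.lt_iff_exists_real_btwn.1 hlt
    obtain ⟨s, hs, hev⟩ := exists_eventually_logLogRatio_lt h (EReal.coe_lt_coe_iff.1 h2)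
    refine limsup_le_of_le (by isBoundedDefault) ?_
    filter_upwards [hev, (tendsto_rpow_nhdsGT_zero (s := 1 + s) (by linarith)).eventually
      (eventually_lt_of_limsup_lt h1)] with ε he hA
    exact (he hA).le
  · refine EReal.le_of_forall_lt_iff_le.1 fun c hlt => ?_
    obtain ⟨c', h1, h2⟩ := EReal.lt_iff_exists_real_btwn.1 hlt
    obtain ⟨s, hs, hev⟩ := exists_eventually_logLogRatio_lt h (EReal.coe_lt_coe_iff.1 h2)
    have hs1 : 0 < 1 + s := by linarith
    -- the power map is a bijection near `0`, so frequently occurring scales pull back along it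
    have hfreq : ∃ᶠ ε in 𝓝[>] (0 : ℝ), logLogRatio (A (ε ^ (1 + s))) (ε ^ (1 + s)) < c' := by
      refine (tendsto_rpow_nhdsGT_zero (inv_pos.2 hs1)).frequently ?_
      refine ((frequently_lt_of_liminf_lt (by isBoundedDefault) h1).and_eventually
        self_mem_nhdsWithin).mono fun ε hε => ?_
      have hpos : 0 ≤ ε := (Set.mem_Ioi.1 hε.2).le
      rw [Real.rpow_inv_rpow hpos hs1.ne']
      exact hε.1
    exact liminf_le_of_frequently_le ((hfreq.and_eventually hev).mono fun ε hε => (hε.2 hε.1).le)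
      (by isBoundedDefault)

/-- Consecutive scales `2 ^ (-j ^ 2)` and the weights `2 ^ (-(j + 1))` differ only by factors that
are subpolynomial in the scale. -/
theorem eventually_exists_scale {s : ℝ} (hs : 0 < s) : ∀ᶠ ε in 𝓝[>] (0 : ℝ), ∃ j : ℕ,
    (1 / 2 : ℝ) ^ (j ^ 2) ≤ ε ∧
      ε ^ (1 + s) < (1 / 2 : ℝ) ^ (j + 1) * (1 / 2) ^ (j ^ 2) / 4 := by
  obtain ⟨J, hJ⟩ := exists_nat_ge (8 / s + 1)
  have hJ' : Set.Ioo (0 : ℝ) ((1 / 2) ^ (J ^ 2)) ∈ 𝓝[>] (0 : ℝ) :=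
    Ioo_mem_nhdsGT (by positivity)
  filter_upwards [hJ'] with ε ⟨h0, h1⟩
  have hex : ∃ j : ℕ, (1 / 2 : ℝ) ^ (j ^ 2) ≤ ε := by
    obtain ⟨n, hn⟩ := exists_pow_lt_of_lt_one h0 (by norm_num : (1 / 2 : ℝ) < 1)
    refine ⟨n, (pow_le_pow_of_le_one (by norm_num) (by norm_num) ?_).trans hn.le⟩
    nlinarith
  classical
  have hfind := Nat.find_spec hex
  have hJlt : J < Nat.find hex := by
    by_contra! hle
    refine h1.not_ge (le_trans ?_ hfind)
    exact pow_le_pow_of_le_one (by norm_num) (by norm_num) (by gcongr)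
  obtain ⟨k, hk⟩ : ∃ k, Nat.find hex = k + 1 := ⟨Nat.find hex - 1, by omega⟩
  have hkJ : J ≤ k := by omega
  have hlt : ε < (1 / 2 : ℝ) ^ (k ^ 2) := not_le.1 (Nat.find_min hex (by omega))
  rw [hk] at hfind
  refine ⟨k + 1, hfind, ?_⟩
  have hkr : 8 / s + 1 ≤ k := hJ.trans (by exact_mod_cast hkJ)
  have h8 : 0 < 8 / s := by positivity
  have hk1 : (1 : ℝ) ≤ k := by linarith
  have hks : 8 ≤ k * s := by
    rw [← div_le_iff₀ hs]; linarith
  have hexp : ((((k + 1) + 1) + (k + 1) ^ 2 + 2 : ℕ) : ℝ) ≤ ((k ^ 2 : ℕ) : ℝ) * (1 + s) := by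
    push_cast
    nlinarith
  calc ε ^ (1 + s) < ((1 / 2 : ℝ) ^ (k ^ 2)) ^ (1 + s) :=
        Real.rpow_lt_rpow h0.le hlt (by linarith)
    _ = (1 / 2 : ℝ) ^ (((k ^ 2 : ℕ) : ℝ) * (1 + s)) := by
        rw [← Real.rpow_natCast, ← Real.rpow_mul (by norm_num)]
    _ ≤ (1 / 2 : ℝ) ^ ((((k + 1) + 1) + (k + 1) ^ 2 + 2 : ℕ) : ℝ) :=
        Real.rpow_le_rpow_of_exponent_ge (by norm_num) (by norm_num) hexp
    _ = (1 / 2 : ℝ) ^ (k + 1 + 1) * (1 / 2) ^ ((k + 1) ^ 2) / 4 := by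
        rw [Real.rpow_natCast, pow_add, pow_add]; ring

end Emergence

theorem mainTheorem4 {X : Type*} [MetricSpace X] [CompactSpace X] [Nonempty X]
    [MeasurableSpace X] [BorelSpace X]
    (D : Measure X → Measure X → ℝ≥0∞) (hD : D ∈ Emergence.admissibleDistances X)
    (f : X → X) (hf : Continuous f) :
    ∃ μ : Measure X, IsProbabilityMeasure μ ∧ MeasurePreserving f μ μ ∧
      limsup (fun ε : ℝ => Emergence.logLogRatio (Emergence.metricEmergence D f μ ε) ε) (𝓝[>] 0)
        = limsup (fun ε : ℝ => Emergence.logLogRatio (Emergence.topologicalEmergence D f ε) ε)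
            (𝓝[>] 0) ∧
      liminf (fun ε : ℝ => Emergence.logLogRatio (Emergence.metricEmergence D f μ ε) ε) (𝓝[>] 0)
        = liminf (fun ε : ℝ => Emergence.logLogRatio (Emergence.topologicalEmergence D f ε) ε)
            (𝓝[>] 0) := by
  have hP := Emergence.isPartitionDist_of_mem_admissibleDistances hD
  obtain ⟨μ, hμ, hfμ, hle, hge⟩ := Emergence.exists_invariant_metricEmergence hP hf.measurable
    (Emergence.exists_ergodic_probabilityMeasure hf)
  refine ⟨μ, hμ, hfμ, Emergence.limsup_liminf_logLogRatio_eq hle fun s hs => ?_⟩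
  filter_upwards [Emergence.eventually_exists_scale hs] with ε ⟨j, hj, hj'⟩
  exact (Emergence.topologicalEmergence_antitone D f hj).trans (hge j _ hj')
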